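/- For $\tau$ in the upper half-plane let $q=e^{2\pi i\tau}$ and let $\eta(\tau)=e^{\pi i\tau/12}\prod_{n\ge1}(1-q^n)$ be the Dedekind eta function. Let \[ \Phi_2(q)=\frac{\eta(2\tau)}{\eta(\tau)^2},\qquad G_8(q)=\frac{\eta(8\tau)^4\,\eta(2\tau)^2}{\eta(4\tau)^2\,\eta(\tau)^4}, \] regarded as power series in $q$, and let $U_2$ be the operator $\bigl(\sum_{n\ge0}a(n)q^n\bigr)|U_2=\sum_{n\ge0}a(2n)q^n$. Let $\pi_2$ denote the $2$-adic valuation on $\mathbb Z$, with $\pi_2(0)=\infty$. Then for every integer $j\ge1$ there exist integers $t_{jr}$ $(\lceil j/2\rceil\le r\le 2j)$ and $u_{jr}$ $(r\ge1)$ such that, as identities of power series in $q$, \[ G_8^j|U_2=\sum_{r=\lceil j/2\rceil}^{2j}t_{jr}\,G_8^r,\qquad \bigl(\Phi_2(-q)\,G_8^j\bigr)|U_2=\Phi_2(-q^2)\sum_{r=1}^{\infty}u_{jr}\,G_8^r, \] where \[ \pi_2(t_{jr})\ge 2r-j,\qquad \pi_2(u_{jr})\ge 2r-j \] for all $r$ in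 the respective ranges. (The infinite sum converges coefficientwise, since $G_8$ has zero constant term.) -/

import Mathlib

noncomputable section

namespace Overpartition

open UpperHalfPlane hiding I
open ModularForm
open scoped Manifold

/-- The eta-quotient `φ₂(τ) = η(2τ) / η(τ)²` on the upper half-plane
(`ModularForm.eta` is the Dedekind eta function). -/
def phi2 (τ : ℍ) : ℂ := eta (2 * τ) / eta τ ^ 2

/-- The eta-quotient `g₈(τ) = η(8τ)⁴ η(2τ)² / (η(4τ)² η(τ)⁴)` on the upper half-plane. -/
def g8 (τ : ℍ) : ℂ :=
  (eta (8 * τ) ^ 4 * eta (2 * τ) ^ 2) / (eta (4 * τ) ^ 2 * eta τ ^ 4)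

/-- `Φ₂(q)`: the expansion of `φ₂(τ)` in powers of `q = e^{2πiτ}`. -/
def Phi2 : PowerSeries ℂ := qExpansion 1 phi2

/-- `G₈(q)`: the expansion of `g₈(τ)` in powers of `q = e^{2πiτ}`. -/
def G8 : PowerSeries ℂ := qExpansion 1 g8

/-- `Φ₂(-q)`. -/
def Phi2Neg : PowerSeries ℂ := PowerSeries.evalNegHom Phi2

/-- `Φ₂(-q²)`, that is `Φ₂(-q)` with `q²` substituted for `q`. -/
def Phi2NegSq : PowerSeries ℂ := PowerSeries.expand 2 two_ne_zero Phi2Neg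

/-- The Atkin operator `U_p`: `(∑ a(n) qⁿ) | U_p = ∑ a(pn) qⁿ`. -/
def atkinU (p : ℕ) (f : PowerSeries ℂ) : PowerSeries ℂ :=
  PowerSeries.mk fun n => PowerSeries.coeff (p * n) f

/-! `Phi2` and `G8` are genuine `q`-expansions: they converge to the eta-quotients. -/

theorem hasSum_qExpansion_of_differentiableOn {f : ℍ → ℂ} {F : ℂ → ℂ}
    (hF : DifferentiableOn ℂ F (Metric.ball 0 1))
    (hf : ∀ τ : ℍ, f τ = F (Function.Periodic.qParam 1 τ)) (τ : ℍ) :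
    HasSum (fun n : ℕ => PowerSeries.coeff n (qExpansion 1 f)
      * Function.Periodic.qParam 1 τ ^ n) (f τ) := by
  have hq (τ : ℍ) : Function.Periodic.qParam 1 τ ∈ Metric.ball (0 : ℂ) 1 := by
    simpa using norm_qParam_lt_one 1 τ
  have hbdd : IsBoundedAtImInfty f := by
    refine isBoundedAtImInfty_of_hasSum_qExpansion (h := 1)
      (c := fun n => (n.factorial : ℂ)⁻¹ * iteratedDeriv n F 0) one_pos fun τ => ?_
    rw [hf τ]
    have h := Complex.hasSum_taylorSeries_on_ball hF (hq τ)
    simp only [smul_eq_mul, sub_zero] at h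
    simpa only [smul_eq_mul, mul_assoc, mul_comm (iteratedDeriv _ F 0)] using h
  have hext : ∀ z : ℂ, 0 < z.im → (f ∘ ofComplex) z = F (Function.Periodic.qParam 1 z) := by
    intro z hz
    simp [ofComplex_apply_of_im_pos hz, hf]
  have hper : Function.Periodic (f ∘ ofComplex) (1 : ℝ) := by
    intro w
    by_cases hw : 0 < w.im
    · have h1 : 0 < (w + ((1 : ℝ) : ℂ)).im := by simpa using hw
      rw [hext _ hw, hext _ h1]
      congr 1
      simp [Function.Periodic.qParam, mul_add, Complex.exp_add]
    · have h1 : (w + ((1 : ℝ) : ℂ)).im ≤ 0 := by simpa using hw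
      simp only [Function.comp_apply, ofComplex_apply_of_im_nonpos h1,
        ofComplex_apply_of_im_nonpos (not_lt.mp hw)]
  have hhol : MDiff f := by
    intro τ
    rw [UpperHalfPlane.mdifferentiableAt_iff]
    have h1 : DifferentiableAt ℂ (fun z : ℂ => F (Function.Periodic.qParam 1 z)) τ :=
      (hF.differentiableAt (Metric.isOpen_ball.mem_nhds (hq τ))).comp (τ : ℂ) (by fun_prop)
    refine h1.congr_of_eventuallyEq ?_
    filter_upwards [isOpen_upperHalfPlaneSet.mem_nhds τ.im_pos] with z hz using hext z hz
  simpa using hasSum_qExpansion one_pos hper hhol hbdd τ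

/-- The Euler product `∏ (1 - qⁿ)`, `n ≥ 1`. -/
def eulerProd (q : ℂ) : ℂ := ∏' n : ℕ, (1 - q ^ (n + 1))

theorem eta_nat_mul (k : ℕ) (τ : ℂ) :
    eta (k * τ) = Function.Periodic.qParam 24 τ ^ k
      * eulerProd (Function.Periodic.qParam 1 τ ^ k) := by
  have h (h : ℝ) : Function.Periodic.qParam h (k * τ) = Function.Periodic.qParam h τ ^ k := by
    simp only [Function.Periodic.qParam, ← Complex.exp_nat_mul]
    congr 1
    ring
  simp only [eta, eta_q, eulerProd, h]

theorem eulerProd_ne_zero {q : ℂ} (hq : ‖q‖ < 1) : eulerProd q ≠ 0 := by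
  have h0 : ∀ n : ℕ, 1 + -q ^ (n + 1) ≠ 0 := by
    intro n h
    have h1 : q ^ (n + 1) = 1 := by linear_combination -h
    have h2 : ‖q‖ ^ (n + 1) < 1 := pow_lt_one₀ (norm_nonneg _) hq (by simp)
    rw [← norm_pow, h1] at h2
    simp at h2
  have := tprod_one_add_ne_zero_of_summable (f := fun n : ℕ => -q ^ (n + 1)) h0
    (by simpa using ((summable_nat_add_iff 1).mpr
      (summable_geometric_of_lt_one (norm_nonneg q) hq) :
        Summable fun n : ℕ => ‖q‖ ^ (n + 1)))
  simpa only [eulerProd, sub_eq_add_neg] using this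

theorem differentiableOn_eulerProd_pow (k : ℕ) (hk : k ≠ 0) :
    DifferentiableOn ℂ (fun q => eulerProd (q ^ k)) (Metric.ball 0 1) := by
  refine DifferentiableOn.comp (g := eulerProd) (f := fun q : ℂ => q ^ k)
    differentiableOn_tprod_one_sub_pow (by fun_prop) fun q hq => ?_
  simp only [Metric.mem_ball, dist_zero_right] at hq ⊢
  simpa using pow_lt_one₀ (norm_nonneg _) hq hk

theorem eulerProd_pow_ne_zero {q : ℂ} (hq : q ∈ Metric.ball (0 : ℂ) 1) (k : ℕ) (hk : k ≠ 0) :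
    eulerProd (q ^ k) ≠ 0 := by
  apply eulerProd_ne_zero
  simp only [Metric.mem_ball, dist_zero_right] at hq
  simpa using pow_lt_one₀ (norm_nonneg _) hq hk

theorem qParam_24_pow (τ : ℂ) :
    Function.Periodic.qParam 24 τ ^ 24 = Function.Periodic.qParam 1 τ := by
  simp only [Function.Periodic.qParam, ← Complex.exp_nat_mul]
  congr 1
  push_cast
  ring

theorem hasSum_Phi2 (τ : ℍ) :
    HasSum (fun n : ℕ => PowerSeries.coeff n Phi2 * Function.Periodic.qParam 1 τ ^ n)
      (phi2 τ) := by
  refine hasSum_qExpansion_of_differentiableOn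
    (F := fun q => eulerProd (q ^ 2) / eulerProd (q ^ 1) ^ 2) ?_ ?_ τ
  · exact (differentiableOn_eulerProd_pow 2 (by simp)).div
      ((differentiableOn_eulerProd_pow 1 (by simp)).pow 2)
      fun q hq => pow_ne_zero _ (eulerProd_pow_ne_zero hq 1 (by simp))
  · intro τ
    have e1 := eta_nat_mul 1 τ
    have e2 := eta_nat_mul 2 τ
    have h0 : Function.Periodic.qParam 24 (τ : ℂ) ≠ 0 := Function.Periodic.qParam_ne_zero _
    have h1 := eulerProd_pow_ne_zero (q := Function.Periodic.qParam 1 τ)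
      (by simpa using norm_qParam_lt_one 1 τ) 1 (by simp)
    push_cast at e1 e2
    rw [one_mul] at e1
    rw [phi2, e1, e2]
    field_simp

theorem hasSum_G8 (τ : ℍ) :
    HasSum (fun n : ℕ => PowerSeries.coeff n G8 * Function.Periodic.qParam 1 τ ^ n)
      (g8 τ) := by
  refine hasSum_qExpansion_of_differentiableOn
    (F := fun q => q * (eulerProd (q ^ 8) ^ 4 * eulerProd (q ^ 2) ^ 2)
      / (eulerProd (q ^ 4) ^ 2 * eulerProd (q ^ 1) ^ 4)) ?_ ?_ τ
  · have d (k : ℕ) (hk : k ≠ 0) (m : ℕ) := (differentiableOn_eulerProd_pow k hk).fun_pow m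
    exact (differentiableOn_id.mul ((d 8 (by simp) 4).mul (d 2 (by simp) 2))).div
      ((d 4 (by simp) 2).mul (d 1 (by simp) 4))
      fun q hq => mul_ne_zero (pow_ne_zero _ (eulerProd_pow_ne_zero hq 4 (by simp)))
        (pow_ne_zero _ (eulerProd_pow_ne_zero hq 1 (by simp)))
  · intro τ
    have e1 := eta_nat_mul 1 τ
    have e2 := eta_nat_mul 2 τ
    have e4 := eta_nat_mul 4 τ
    have e8 := eta_nat_mul 8 τ
    have h0 : Function.Periodic.qParam 24 (τ : ℂ) ≠ 0 := Function.Periodic.qParam_ne_zero _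
    have hn (k : ℕ) (hk : k ≠ 0) := eulerProd_pow_ne_zero (q := Function.Periodic.qParam 1 τ)
      (by simpa using norm_qParam_lt_one 1 τ) k hk
    have h1 := hn 1 (by simp)
    have h4 := hn 4 (by simp)
    push_cast at e1 e2 e4 e8
    rw [one_mul] at e1
    rw [g8, e1, e2, e4, e8, div_eq_div_iff
      (mul_ne_zero (pow_ne_zero _ (mul_ne_zero (pow_ne_zero _ h0) h4))
        (pow_ne_zero _ (mul_ne_zero (pow_ne_zero _ h0) h1)))
      (mul_ne_zero (pow_ne_zero _ h4) (pow_ne_zero _ h1)), ← qParam_24_pow τ]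
    ring

end Overpartition

end

/-! Write x = G₈(q), y = G₈(-q), w = G₈(q²) and S = w + 4w². Everything rests on x + y = 8S and xy =
-S (`G8_add_evalNeg`, `G8_mul_evalNeg`). Since F(q) + F(-q) is twice F|U₂ with q² substituted for q,
the series G₈ʲ|U₂ and (Φ₂(-q)G₈ʲ)|U₂ are, up to this factor and Φ₂(-q²), the sums Axʲ + Byʲ, where
(A, B) is (1, 1) or (1/φ(q), 1/φ(-q)). Both therefore satisfy P(j+2) = 8S·P(j+1) + S·P(j) and are
integer polynomials in G₈, determined by their values at j = 0, 1.

The 2-adic bound passes through the recurrence (`isAdmissible_recPoly`): in S each degree gained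
beyond the first costs a factor 4, and the 8 pays for the shift from j+1 to j.

The two relations and the four initial values come from theta functions. With A = φ(q) and B =
φ(-q), one has G₈(q) = (A² - B²)/(8B²), G₈(q²) = (A - B)²/(16AB) and φ(q⁴) = (A + B)/2, so each is a
rational identity in A and B. These formulas need only product manipulations and the 2-dissection
`thetaPhi_eq_add`, which follows from the Jacobi triple product. -/

noncomputable section

namespace Overpartition

/-! ### Infinite q-products and the finite q-binomial theorem -/

section GaussianBinomial

open Filter Topology

/-- The `q`-Pochhammer product `∏ (1 + a qᵏ)`, `k ≥ 0`. -/
def qPoch (a q : ℂ) : ℂ := ∏' k : ℕ, (1 + a * q ^ k)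

theorem summable_norm_mul_pow (a : ℂ) {q : ℂ} (hq : ‖q‖ < 1) :
    Summable fun k : ℕ => ‖a * q ^ k‖ := by
  simpa using (summable_geometric_of_lt_one (norm_nonneg q) hq).mul_left ‖a‖

theorem multipliable_qPoch (a : ℂ) {q : ℂ} (hq : ‖q‖ < 1) :
    Multipliable fun k : ℕ => 1 + a * q ^ k :=
  multipliable_one_add_of_summable (summable_norm_mul_pow a hq)

theorem norm_sq_lt_one {q : ℂ} (hq : ‖q‖ < 1) : ‖q ^ 2‖ < 1 := by
  simpa using pow_lt_one₀ (norm_nonneg q) hq two_ne_zero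

theorem eulerProd_eq_qPoch (q : ℂ) : eulerProd q = qPoch (-q) q := by
  simp only [eulerProd, qPoch]
  congr 1
  ext k
  ring

theorem tendsto_prod_qPoch (a : ℂ) {q : ℂ} (hq : ‖q‖ < 1) :
    Tendsto (fun n => ∏ k ∈ Finset.range n, (1 + a * q ^ k)) atTop (𝓝 (qPoch a q)) :=
  (multipliable_qPoch a hq).hasProd.tendsto_prod_nat

theorem qPoch_eq_mul (a : ℂ) {q : ℂ} (hq : ‖q‖ < 1) :
    qPoch a q = (1 + a) * qPoch (a * q) q := by
  refine tendsto_nhds_unique ((tendsto_prod_qPoch a hq).comp (tendsto_add_atTop_nat 1)) ?_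
  refine ((tendsto_prod_qPoch (a * q) hq).const_mul (1 + a)).congr fun n => ?_
  simp only [Function.comp_apply, Finset.prod_range_succ', pow_zero, mul_one]
  rw [mul_comm]
  congr 1
  refine Finset.prod_congr rfl fun k _ => ?_
  ring

theorem qPoch_even_mul_odd (a : ℂ) {q : ℂ} (hq : ‖q‖ < 1) :
    qPoch a q = qPoch a (q ^ 2) * qPoch (a * q) (q ^ 2) := by
  have h2 := norm_sq_lt_one hq
  refine tendsto_nhds_unique ((tendsto_prod_qPoch a hq).comp
    (tendsto_id.const_mul_atTop' (two_pos : 0 < 2))) ?_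
  refine ((tendsto_prod_qPoch a h2).mul (tendsto_prod_qPoch (a * q) h2)).congr fun n => ?_
  simp only [Function.comp_apply, id]
  induction n with
  | zero => simp
  | succ n ih =>
    rw [show 2 * (n + 1) = 2 * n + 1 + 1 by ring]
    simp only [Finset.prod_range_succ, ← ih]
    ring

theorem qPoch_mul_neg (a : ℂ) {q : ℂ} (hq : ‖q‖ < 1) :
    qPoch a q * qPoch (-a) q = qPoch (-a ^ 2) (q ^ 2) := by
  refine tendsto_nhds_unique
    ((tendsto_prod_qPoch a hq).mul (tendsto_prod_qPoch (-a) hq)) ?_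
  refine (tendsto_prod_qPoch (-a ^ 2) (norm_sq_lt_one hq)).congr fun n => ?_
  rw [← Finset.prod_mul_distrib]
  refine Finset.prod_congr rfl fun k _ => ?_
  ring

/-- The Gaussian binomial coefficients, evaluated at `q`. -/
def gaussBinom (q : ℂ) : ℕ → ℕ → ℂ
  | _, 0 => 1
  | 0, _ + 1 => 0
  | n + 1, k + 1 => gaussBinom q n k + q ^ (k + 1) * gaussBinom q n (k + 1)

theorem gaussBinom_zero_right (q : ℂ) (n : ℕ) : gaussBinom q n 0 = 1 := by
  cases n <;> rfl

theorem gaussBinom_succ_succ (q : ℂ) (n k : ℕ) : gaussBinom q (n + 1) (k + 1) =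
    gaussBinom q n k + q ^ (k + 1) * gaussBinom q n (k + 1) := rfl

theorem gaussBinom_eq_zero (q : ℂ) {n k : ℕ} (h : n < k) : gaussBinom q n k = 0 := by
  induction n generalizing k with
  | zero => obtain ⟨k, rfl⟩ := Nat.exists_eq_succ_of_ne_zero h.ne'; rfl
  | succ n ih =>
    obtain ⟨k, rfl⟩ := Nat.exists_eq_succ_of_ne_zero (Nat.ne_zero_of_lt h)
    rw [Nat.succ_eq_add_one, gaussBinom_succ_succ, ih (by omega), ih (by omega)]
    simp

/-- The factorial formula, cleared of denominators so that it also holds when q is a root of unity.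
The Pascal rule drives a double induction on k and n. -/
theorem gaussBinom_add_mul (q : ℂ) (n k : ℕ) :
    gaussBinom q (n + k) k *
        ((∏ i ∈ Finset.range k, (1 - q ^ (i + 1))) * ∏ i ∈ Finset.range n, (1 - q ^ (i + 1)))
      = ∏ i ∈ Finset.range (n + k), (1 - q ^ (i + 1)) := by
  induction k generalizing n with
  | zero => simp [gaussBinom_zero_right]
  | succ k ihk =>
    induction n with
    | zero =>
      have := ihk 0
      simp only [zero_add, Finset.range_zero, Finset.prod_empty, mul_one] at this ⊢
      rw [gaussBinom_succ_succ, gaussBinom_eq_zero q (Nat.lt_succ_self k), mul_zero, add_zero,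
        Finset.prod_range_succ, ← mul_assoc, this]
    | succ n ihn =>
      have h1 := ihk (n + 1)
      rw [show n + 1 + (k + 1) = (n + k + 1) + 1 by ring, gaussBinom_succ_succ,
        Finset.prod_range_succ (n := n + k + 1)]
      rw [show n + 1 + k = n + k + 1 by ring, Finset.prod_range_succ (n := n)] at h1
      rw [show n + (k + 1) = n + k + 1 by ring, Finset.prod_range_succ (n := k)] at ihn
      rw [Finset.prod_range_succ (n := k), Finset.prod_range_succ (n := n)]
      linear_combination (1 - q ^ (k + 1)) * h1 + q ^ (k + 1) * (1 - q ^ (n + 1)) * ihn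

/-- The finite `q`-binomial theorem. -/
theorem prod_one_add_mul_pow (q x : ℂ) (N : ℕ) :
    ∏ k ∈ Finset.range N, (1 + x * q ^ k)
      = ∑ j ∈ Finset.range (N + 1), gaussBinom q N j * q ^ (j.choose 2) * x ^ j := by
  induction N generalizing x with
  | zero => simp [gaussBinom_zero_right]
  | succ N ih =>
    have h : ∏ k ∈ Finset.range (N + 1), (1 + x * q ^ k)
        = (1 + x) * ∏ k ∈ Finset.range N, (1 + (x * q) * q ^ k) := by
      rw [Finset.prod_range_succ', pow_zero, mul_one, mul_comm]
      congr 1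
      refine Finset.prod_congr rfl fun k _ => ?_
      ring
    have h' : ∑ j ∈ Finset.range (N + 1), gaussBinom q N j * q ^ (j.choose 2) * (x * q) ^ j
        = ∑ j ∈ Finset.range (N + 1),
            gaussBinom q N (j + 1) * q ^ ((j + 1).choose 2) * (x * q) ^ (j + 1) + 1 := by
      rw [Finset.sum_range_succ', Finset.sum_range_succ _ N,
        gaussBinom_eq_zero q (Nat.lt_succ_self N)]
      simp [gaussBinom_zero_right]
    rw [h, ih, add_mul, one_mul, Finset.sum_range_succ' _ (N + 1)]
    nth_rewrite 1 [h']
    rw [Finset.mul_sum, add_right_comm, ← Finset.sum_add_distrib]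
    congr 1
    · refine Finset.sum_congr rfl fun j _ => ?_
      rw [gaussBinom_succ_succ, Nat.choose_succ_succ' j 1, Nat.choose_one_right]
      ring
    · simp [gaussBinom_zero_right]

end GaussianBinomial

/-! ### The Jacobi triple product, as a limit of its finite form -/

section TripleProduct

open Filter Topology

/-- After reversing the order, the factors on the left are 1 + zq^(-(2i+1)). Multiplying each by
q^(2i+1) turns it into z(1 + z⁻¹q^(2i+1)), and the odd exponents add up to n². -/
theorem prod_reflect_eq {q z : ℂ} (hq : q ≠ 0) (hz : z ≠ 0) (n : ℕ) :
    (∏ i ∈ Finset.range n, (1 + z * q / (q ^ n) ^ 2 * (q ^ 2) ^ i)) * q ^ (n ^ 2)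
      = z ^ n * ∏ i ∈ Finset.range n, (1 + z⁻¹ * q * (q ^ 2) ^ i) := by
  have h : q ^ (n ^ 2) = ∏ i ∈ Finset.range n, q ^ (2 * i + 1) := by
    rw [Finset.prod_pow_eq_pow_sum]
    congr 1
    induction n with
    | zero => simp
    | succ n ih => rw [Finset.sum_range_succ, ← ih]; ring
  rw [← Finset.prod_range_reflect, h, ← Finset.prod_mul_distrib,
    show z ^ n = ∏ _i ∈ Finset.range n, z by simp, ← Finset.prod_mul_distrib]
  refine Finset.prod_congr rfl fun i hi => ?_
  obtain ⟨m, rfl⟩ := Nat.exists_eq_add_of_lt (Finset.mem_range.mp hi)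
  rw [show i + m + 1 - 1 - i = m by omega]
  field_simp
  ring

/-- The finite form of the Jacobi triple product identity. -/
theorem finite_jacobi_triple_product {q z : ℂ} (hq : q ≠ 0) (hz : z ≠ 0) (n : ℕ) :
    (∏ i ∈ Finset.range n, (1 + z * q * (q ^ 2) ^ i))
        * ∏ i ∈ Finset.range n, (1 + z⁻¹ * q * (q ^ 2) ^ i)
      = ∑ j ∈ Finset.range (2 * n + 1),
          gaussBinom (q ^ 2) (2 * n) j * (z ^ ((j : ℤ) - n) * q ^ (((j : ℤ) - n) ^ 2)) := by
  -- The shift by q^(-2n) centres the product: its upper n factors are those in z, its lower n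
  -- factors reflect to those in z⁻¹.
  have h := prod_one_add_mul_pow (q ^ 2) (z * q / (q ^ n) ^ 2) (2 * n)
  have h1 : ∏ i ∈ Finset.range n, (1 + z * q / (q ^ n) ^ 2 * (q ^ 2) ^ (n + i))
      = ∏ i ∈ Finset.range n, (1 + z * q * (q ^ 2) ^ i) := by
    refine Finset.prod_congr rfl fun i _ => ?_
    field_simp
    ring
  rw [two_mul, Finset.prod_range_add, h1, ← two_mul] at h
  refine mul_left_cancel₀ (pow_ne_zero n hz) ?_
  rw [mul_left_comm, ← prod_reflect_eq hq hz, mul_comm, mul_right_comm, h, Finset.sum_mul,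
    Finset.mul_sum]
  refine Finset.sum_congr rfl fun j _ => ?_
  have hj : j ^ 2 = 2 * j.choose 2 + j := by
    rw [Nat.choose_two_right, Nat.mul_div_cancel' (Nat.even_mul_pred_self j).two_dvd]
    cases j with
    | zero => rfl
    | succ j => simp only [Nat.add_sub_cancel]; ring
  have e1 : q ^ (((j : ℤ) - n) ^ 2) = q ^ (j ^ 2) * q ^ (n ^ 2) / q ^ (2 * n * j) := by
    rw [← zpow_natCast, ← zpow_natCast, ← zpow_natCast, ← zpow_add₀ hq, ← zpow_sub₀ hq]
    congr 1
    push_cast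
    ring
  have e2 : z ^ ((j : ℤ) - n) = z ^ j / z ^ n := by
    rw [zpow_sub₀ hz, zpow_natCast, zpow_natCast]
  rw [e1, e2, hj, div_pow, show ((q ^ n) ^ 2) ^ j = q ^ (2 * n * j) by ring]
  field_simp
  ring

/-- The coefficients of the finite Jacobi triple product. -/
def tripleCoeff (Q : ℂ) (n : ℕ) (m : ℤ) : ℂ :=
  if 0 ≤ (n : ℤ) + m then gaussBinom Q (2 * n) ((n : ℤ) + m).toNat else 0

theorem hasSum_finite_jacobi_triple_product {q z : ℂ} (hq : q ≠ 0) (hz : z ≠ 0) (n : ℕ) :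
    HasSum (fun m : ℤ => tripleCoeff (q ^ 2) n m * (z ^ m * q ^ (m ^ 2)))
      ((∏ i ∈ Finset.range n, (1 + z * q * (q ^ 2) ^ i))
        * ∏ i ∈ Finset.range n, (1 + z⁻¹ * q * (q ^ 2) ^ i)) := by
  rw [finite_jacobi_triple_product hq hz]
  have hinj : Function.Injective fun j : ℕ => (j : ℤ) - n := fun a b h => by
    simpa using h
  rw [← hinj.hasSum_iff]
  · have h (j : ℕ) : tripleCoeff (q ^ 2) n ((j : ℤ) - n) = gaussBinom (q ^ 2) (2 * n) j := by
      simp [tripleCoeff]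
    simp only [Function.comp_def, h]
    refine hasSum_sum_of_ne_finset_zero fun j hj => ?_
    rw [gaussBinom_eq_zero, zero_mul]
    simp only [Finset.mem_range] at hj
    omega
  · intro m hm
    rw [tripleCoeff, if_neg, zero_mul]
    intro h
    exact hm ⟨((n : ℤ) + m).toNat, by simp only [Int.toNat_of_nonneg h]; ring⟩

theorem eulerProd_tendsto {Q : ℂ} (hQ : ‖Q‖ < 1) :
    Tendsto (fun n => ∏ i ∈ Finset.range n, (1 - Q ^ (i + 1))) atTop (𝓝 (eulerProd Q)) :=
  (ModularForm.multipliable_one_sub_pow hQ).hasProd.tendsto_prod_nat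

theorem prod_one_sub_pow_ne_zero {Q : ℂ} (hQ : ‖Q‖ < 1) (n : ℕ) :
    ∏ i ∈ Finset.range n, (1 - Q ^ (i + 1)) ≠ 0 := by
  refine Finset.prod_ne_zero_iff.mpr fun i _ h => ?_
  have h2 : ‖Q‖ ^ (i + 1) < 1 := pow_lt_one₀ (norm_nonneg _) hQ (by simp)
  rw [← norm_pow, ← sub_eq_zero.mp h] at h2
  simp at h2

theorem tripleCoeff_eq {Q : ℂ} (hQ : ‖Q‖ < 1) {n : ℕ} {m : ℤ} (h1 : 0 ≤ (n : ℤ) + m)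
    (h2 : 0 ≤ (n : ℤ) - m) : tripleCoeff Q n m =
      (∏ i ∈ Finset.range (2 * n), (1 - Q ^ (i + 1)))
        * ((∏ i ∈ Finset.range ((n : ℤ) + m).toNat, (1 - Q ^ (i + 1)))⁻¹
          * (∏ i ∈ Finset.range ((n : ℤ) - m).toNat, (1 - Q ^ (i + 1)))⁻¹) := by
  have h := gaussBinom_add_mul Q ((n : ℤ) - m).toNat ((n : ℤ) + m).toNat
  have h3 : ((n : ℤ) - m).toNat + ((n : ℤ) + m).toNat = 2 * n := by omega
  rw [h3] at h
  have ha := prod_one_sub_pow_ne_zero hQ ((n : ℤ) + m).toNat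
  have hb := prod_one_sub_pow_ne_zero hQ ((n : ℤ) - m).toNat
  rw [tripleCoeff, if_pos h1, ← h]
  field_simp

theorem tendsto_tripleCoeff {Q : ℂ} (hQ : ‖Q‖ < 1) (m : ℤ) :
    Tendsto (fun n => tripleCoeff Q n m) atTop (𝓝 (eulerProd Q)⁻¹) := by
  have hE := eulerProd_ne_zero hQ
  have t := eulerProd_tendsto hQ
  have t0 := t.comp (tendsto_id.const_mul_atTop' (two_pos : 0 < 2))
  have hp (k : ℤ) : Tendsto (fun n : ℕ => ((n : ℤ) + k).toNat) atTop atTop :=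
    tendsto_atTop.mpr fun b => by
      filter_upwards [eventually_ge_atTop (b + k.natAbs)] with n hn
      omega
  have t1 := (t.comp (hp m)).inv₀ hE
  have t2 := (t.comp (hp (-m))).inv₀ hE
  have T := t0.mul (t1.mul t2)
  rw [show eulerProd Q * ((eulerProd Q)⁻¹ * (eulerProd Q)⁻¹) = (eulerProd Q)⁻¹ by
    field_simp] at T
  refine T.congr' ?_
  filter_upwards [eventually_ge_atTop m.natAbs] with n hn
  rw [tripleCoeff_eq hQ (by omega) (by omega)]
  rfl

/-- Uniformity in both n and m is what dominated convergence needs. It holds because the partial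
Euler products and their inverses converge, hence are bounded. -/
theorem exists_norm_tripleCoeff_le {Q : ℂ} (hQ : ‖Q‖ < 1) :
    ∃ K : ℝ, ∀ n m, ‖tripleCoeff Q n m‖ ≤ K := by
  have hE := eulerProd_ne_zero hQ
  have t := eulerProd_tendsto hQ
  obtain ⟨A, hA⟩ := t.norm.bddAbove_range
  obtain ⟨B, hB⟩ := (t.inv₀ hE).norm.bddAbove_range
  simp only [upperBounds, Set.forall_mem_range, Set.mem_ofPred_eq] at hA hB
  have hA0 : 0 ≤ A := (norm_nonneg _).trans (hA 0)
  have hB0 : 0 ≤ B := (norm_nonneg _).trans (hB 0)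
  refine ⟨A * (B * B), fun n m => ?_⟩
  by_cases h1 : 0 ≤ (n : ℤ) + m
  · by_cases h2 : 0 ≤ (n : ℤ) - m
    · rw [tripleCoeff_eq hQ h1 h2, norm_mul, norm_mul]
      gcongr
      exacts [hA _, hB _, hB _]
    · rw [tripleCoeff, if_pos h1, gaussBinom_eq_zero Q (by omega), norm_zero]
      positivity
  · rw [tripleCoeff, if_neg h1, norm_zero]
    positivity

theorem summable_pow_mul_pow_sq (z : ℂ) {q : ℂ} (hq : ‖q‖ < 1) :
    Summable fun n : ℕ => ‖z ^ n * q ^ (n ^ 2)‖ := by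
  have h : Tendsto (fun n : ℕ => ‖z‖ * ‖q‖ ^ (2 * n + 1)) atTop (𝓝 0) := by
    have t : Tendsto (fun n : ℕ => 2 * n + 1) atTop atTop :=
      tendsto_atTop_mono (fun n => by rw [id]; omega) tendsto_id
    simpa using ((tendsto_pow_atTop_nhds_zero_of_lt_one (norm_nonneg q) hq).comp t).const_mul ‖z‖
  -- Ratio test: consecutive terms have ratio ‖z‖‖q‖^(2n+1), which tends to 0.
  refine summable_of_ratio_norm_eventually_le (r := 1 / 2) (by norm_num) ?_
  filter_upwards [h.eventually_le_const (show (0 : ℝ) < 1 / 2 by norm_num)] with n hn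
  refine le_trans (le_of_eq ?_) (mul_le_mul_of_nonneg_right hn (norm_nonneg _))
  simp only [norm_mul, norm_pow, norm_norm]
  ring

theorem summable_zpow_mul_zpow_sq {q : ℂ} (z : ℂ) (hq : ‖q‖ < 1) :
    Summable fun m : ℤ => ‖z ^ m * q ^ (m ^ 2)‖ := by
  refine Summable.of_nat_of_neg ?_ ?_
  · refine (summable_pow_mul_pow_sq z hq).congr fun n => ?_
    rw [zpow_natCast, ← Nat.cast_pow, zpow_natCast]
  · refine (summable_pow_mul_pow_sq z⁻¹ hq).congr fun n => ?_
    rw [zpow_neg, zpow_natCast, neg_sq, ← Nat.cast_pow, zpow_natCast, inv_pow]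

/-- The Jacobi triple product identity. -/
theorem hasSum_jacobi_triple_product {q z : ℂ} (hq0 : q ≠ 0) (hq : ‖q‖ < 1) (hz : z ≠ 0) :
    HasSum (fun m : ℤ => z ^ m * q ^ (m ^ 2))
      (eulerProd (q ^ 2) * (qPoch (z * q) (q ^ 2) * qPoch (z⁻¹ * q) (q ^ 2))) := by
  have h2 := norm_sq_lt_one hq
  have hs := summable_zpow_mul_zpow_sq z hq
  obtain ⟨K, hK⟩ := exists_norm_tripleCoeff_le h2
  have T : Tendsto (fun n => ∑' m : ℤ, tripleCoeff (q ^ 2) n m * (z ^ m * q ^ (m ^ 2))) atTop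
      (𝓝 (∑' m : ℤ, (eulerProd (q ^ 2))⁻¹ * (z ^ m * q ^ (m ^ 2)))) := by
    refine tendsto_tsum_of_dominated_convergence (hs.mul_left K) (fun m => ?_) ?_
    · exact (tendsto_tripleCoeff h2 m).mul_const _
    · refine .of_forall fun n m => ?_
      rw [norm_mul]
      exact mul_le_mul_of_nonneg_right (hK n m) (norm_nonneg _)
  simp only [(hasSum_finite_jacobi_triple_product hq0 hz _).tsum_eq] at T
  have h := tendsto_nhds_unique T
    ((tendsto_prod_qPoch (z * q) h2).mul (tendsto_prod_qPoch (z⁻¹ * q) h2))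
  rw [tsum_mul_left] at h
  rw [← h, mul_inv_cancel_left₀ (eulerProd_ne_zero h2)]
  exact hs.of_norm.hasSum

end TripleProduct

/-! ### Theta function identities and the modular relations on the unit disc -/

section Theta

open Filter Topology

theorem qPoch_one_mul_eulerProd {q : ℂ} (hq : ‖q‖ < 1) :
    qPoch q q * eulerProd q = eulerProd (q ^ 2) := by
  rw [eulerProd_eq_qPoch, qPoch_mul_neg q hq, eulerProd_eq_qPoch]

theorem eulerProd_eq_odd_mul {q : ℂ} (hq : ‖q‖ < 1) :
    eulerProd q = qPoch (-q) (q ^ 2) * eulerProd (q ^ 2) := by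
  rw [eulerProd_eq_qPoch, qPoch_even_mul_odd _ hq, eulerProd_eq_qPoch]
  ring_nf

theorem eulerProd_neg_eq_odd_mul {q : ℂ} (hq : ‖q‖ < 1) :
    eulerProd (-q) = qPoch q (q ^ 2) * eulerProd (q ^ 2) := by
  simpa using eulerProd_eq_odd_mul (q := -q) (by simpa using hq)

/-- The odd-index parts of the products at q and -q multiply to the odd-index part of the product at
q², which the factor at q⁴ completes. -/
theorem eulerProd_neg_mul {q : ℂ} (hq : ‖q‖ < 1) :
    eulerProd (-q) * eulerProd q * eulerProd (q ^ 4) = eulerProd (q ^ 2) ^ 3 := by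
  have h2 := norm_sq_lt_one hq
  have h := qPoch_mul_neg q h2
  have h' := eulerProd_eq_odd_mul h2
  rw [← pow_mul] at h'
  rw [eulerProd_neg_eq_odd_mul hq, eulerProd_eq_odd_mul hq]
  rw [← pow_mul] at h
  linear_combination eulerProd (q ^ 2) ^ 2 * eulerProd (q ^ 4) * h - eulerProd (q ^ 2) ^ 2 * h'

/-- Ramanujan's theta function `φ(q) = ∑ q^(m²)`, as a product. -/
def thetaPhi (q : ℂ) : ℂ := eulerProd (-q) ^ 2 / eulerProd (q ^ 2)

/-- Ramanujan's theta function `ψ(q) = ∑ q^(m(m+1)/2)`, as a product. -/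
def thetaPsi (q : ℂ) : ℂ := eulerProd (q ^ 2) ^ 2 / eulerProd q

theorem norm_pow_lt_one' {q : ℂ} (hq : ‖q‖ < 1) {k : ℕ} (hk : k ≠ 0) : ‖q ^ k‖ < 1 := by
  simpa using pow_lt_one₀ (norm_nonneg q) hq hk

theorem thetaPhi_ne_zero {q : ℂ} (hq : ‖q‖ < 1) : thetaPhi q ≠ 0 :=
  div_ne_zero (pow_ne_zero _ (eulerProd_ne_zero (by simpa using hq)))
    (eulerProd_ne_zero (norm_sq_lt_one hq))

theorem thetaPhi_neg (q : ℂ) : thetaPhi (-q) = eulerProd q ^ 2 / eulerProd (q ^ 2) := by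
  simp [thetaPhi]

theorem thetaPhi_mul_neg {q : ℂ} (hq : ‖q‖ < 1) :
    thetaPhi q * thetaPhi (-q) = thetaPhi (-q ^ 2) ^ 2 := by
  have h := eulerProd_neg_mul hq
  have h2 := eulerProd_ne_zero (norm_pow_lt_one' hq two_ne_zero)
  have h4 := eulerProd_ne_zero (norm_pow_lt_one' hq four_ne_zero)
  rw [thetaPhi_neg, thetaPhi_neg, thetaPhi, ← pow_mul]
  norm_num
  field_simp
  -- The cleared goal is the square of `h`, so a² - b² = (a + b)(a - b) supplies the multiplier.
  linear_combination (eulerProd (-q) * eulerProd q * eulerProd (q ^ 4) + eulerProd (q ^ 2) ^ 3) * h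

theorem thetaPhi_mul_thetaPsi {q : ℂ} (hq : ‖q‖ < 1) :
    thetaPhi q * thetaPsi (q ^ 2) = thetaPsi q ^ 2 := by
  have h := eulerProd_neg_mul hq
  have h1 := eulerProd_ne_zero hq
  have h2 := eulerProd_ne_zero (norm_pow_lt_one' hq two_ne_zero)
  rw [thetaPsi, thetaPsi, thetaPhi, ← pow_mul]
  norm_num
  field_simp
  linear_combination (eulerProd (-q) * eulerProd q * eulerProd (q ^ 4) + eulerProd (q ^ 2) ^ 3) * h

theorem hasSum_thetaPhi {q : ℂ} (hq0 : q ≠ 0) (hq : ‖q‖ < 1) :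
    HasSum (fun m : ℤ => q ^ (m ^ 2)) (thetaPhi q) := by
  have h := hasSum_jacobi_triple_product hq0 hq one_ne_zero
  have h2 := eulerProd_ne_zero (norm_sq_lt_one hq)
  simp only [one_zpow, one_mul, inv_one] at h
  convert h using 1
  rw [thetaPhi, eulerProd_neg_eq_odd_mul hq]
  field_simp

theorem hasSum_thetaPsi {q : ℂ} (hq0 : q ≠ 0) (hq : ‖q‖ < 1) :
    HasSum (fun m : ℤ => q ^ m * q ^ (m ^ 2)) (2 * thetaPsi (q ^ 2)) := by
  have h := hasSum_jacobi_triple_product hq0 hq hq0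
  have h2 := norm_sq_lt_one hq
  have h20 := eulerProd_ne_zero h2
  convert h using 1
  -- At z = q the factor in z⁻¹q = 1 starts with 1 + 1, which is the source of the 2.
  have h3 := qPoch_eq_mul 1 h2
  have h4 := qPoch_one_mul_eulerProd h2
  rw [inv_mul_cancel₀ hq0, h3, thetaPsi, ← h4, one_mul, ← sq]
  field_simp
  ring

/-- Split the sum of q^(m²) by the parity of m: (2m)² = 4m² and (2m+1)² = 4(m² + m) + 1. -/
theorem thetaPhi_eq_add {q : ℂ} (hq : ‖q‖ < 1) :
    thetaPhi q = thetaPhi (q ^ 4) + 2 * q * thetaPsi (q ^ 8) := by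
  rcases eq_or_ne q 0 with rfl | hq0
  · simp
  have h4 := norm_pow_lt_one' hq four_ne_zero
  have h40 := pow_ne_zero 4 hq0
  have he := hasSum_thetaPhi h40 h4
  have ho := (hasSum_thetaPsi h40 h4).mul_left q
  rw [← pow_mul] at ho
  rw [← (hasSum_thetaPhi hq0 hq).tsum_eq]
  have hE : HasSum ((fun m : ℤ => q ^ (m ^ 2)) ∘ fun m => 2 * m) (thetaPhi (q ^ 4)) := by
    refine he.congr_fun fun m => ?_
    rw [Function.comp_apply, ← zpow_natCast, ← zpow_mul]
    congr 1
    push_cast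
    ring
  have hO : HasSum ((fun m : ℤ => q ^ (m ^ 2)) ∘ fun m => 2 * m + 1)
      (q * (2 * thetaPsi (q ^ (4 * 2)))) := by
    refine ho.congr_fun fun m => ?_
    rw [Function.comp_apply, ← zpow_natCast, ← zpow_mul, ← zpow_mul, ← zpow_add₀ hq0,
      ← zpow_one_add₀ hq0]
    congr 1
    push_cast
    ring
  have h2 : Function.Injective fun m : ℤ => 2 * m := mul_right_injective₀ two_ne_zero
  have h2' : Function.Injective fun m : ℤ => 2 * m + 1 := (add_left_injective 1).comp h2
  have hsum := (h2.hasSum_range_iff.2 hE).add_isCompl (by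
    simpa [Function.comp_def] using Int.isCompl_even_odd) (h2'.hasSum_range_iff.2 hO)
  rw [hsum.tsum_eq]
  ring

/-- Put iq for q in φ(q)φ(-q) = φ(-q²)²: by the 2-dissection the left side becomes a product of
conjugate factors φ(q⁴) ± 2iqψ(q⁸). -/
theorem thetaPhi_sq {q : ℂ} (hq : ‖q‖ < 1) :
    thetaPhi (q ^ 2) ^ 2 = thetaPhi (q ^ 4) ^ 2 + 4 * q ^ 2 * thetaPsi (q ^ 8) ^ 2 := by
  have hi : ‖Complex.I * q‖ < 1 := by simpa using hq
  have hi' : ‖-(Complex.I * q)‖ < 1 := by simpa using hq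
  have h := thetaPhi_mul_neg hi
  have e2 : (Complex.I * q) ^ 2 = -q ^ 2 := by rw [mul_pow, Complex.I_sq]; ring
  have e4 : (Complex.I * q) ^ 4 = q ^ 4 := by rw [mul_pow, Complex.I_pow_four]; ring
  have e8 : (Complex.I * q) ^ 8 = q ^ 8 := by
    rw [show 8 = 4 * 2 by rfl, pow_mul, e4, ← pow_mul]
  rw [thetaPhi_eq_add hi, thetaPhi_eq_add hi', Even.neg_pow (by decide), Even.neg_pow (by decide),
    e2, e4, e8, neg_neg] at h
  rw [← h]
  linear_combination (-4 * q ^ 2 * thetaPsi (q ^ 8) ^ 2) * Complex.I_sq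

/-- The function on the unit disc underlying `g8`. -/
def g8Disc (q : ℂ) : ℂ := q * thetaPsi (q ^ 4) ^ 2 / thetaPhi (-q) ^ 2

theorem eight_mul_thetaPsi_sq {q : ℂ} (hq : ‖q‖ < 1) :
    8 * (q * thetaPsi (q ^ 4) ^ 2) = thetaPhi q ^ 2 - thetaPhi (-q) ^ 2 := by
  rw [← thetaPhi_mul_thetaPsi (norm_pow_lt_one' hq four_ne_zero), ← pow_mul,
    thetaPhi_eq_add hq, thetaPhi_eq_add (q := -q) (by simpa using hq),
    Even.neg_pow (by decide), Even.neg_pow (by decide)]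
  ring

theorem g8Disc_eq {q : ℂ} (hq : ‖q‖ < 1) :
    g8Disc q = (thetaPhi q ^ 2 - thetaPhi (-q) ^ 2) / (8 * thetaPhi (-q) ^ 2) := by
  have h := thetaPhi_ne_zero (q := -q) (by simpa using hq)
  rw [g8Disc, ← eight_mul_thetaPsi_sq hq]
  field_simp

/-- Here φ(-q²)² = AB, and φ(q²)² = (A² + B²)/2 because φ(q⁴) and 2qψ(q⁸) are the half-sum and
half-difference of A = φ(q) and B = φ(-q). -/
theorem g8Disc_sq_eq {q : ℂ} (hq : ‖q‖ < 1) :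
    g8Disc (q ^ 2) = (thetaPhi q - thetaPhi (-q)) ^ 2 / (16 * (thetaPhi q * thetaPhi (-q))) := by
  have hA := thetaPhi_ne_zero hq
  have hB := thetaPhi_ne_zero (q := -q) (by simpa using hq)
  rw [g8Disc_eq (norm_sq_lt_one hq), ← thetaPhi_mul_neg hq, thetaPhi_sq hq]
  rw [div_eq_div_iff (by simp [hA, hB]) (by simp [hA, hB])]
  rw [thetaPhi_eq_add hq, thetaPhi_eq_add (q := -q) (by simpa using hq),
    Even.neg_pow (by decide), Even.neg_pow (by decide)]
  ring

theorem thetaPhi_pow_four {q : ℂ} (hq : ‖q‖ < 1) :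
    thetaPhi (q ^ 4) = (thetaPhi q + thetaPhi (-q)) / 2 := by
  rw [thetaPhi_eq_add hq, thetaPhi_eq_add (q := -q) (by simpa using hq),
    Even.neg_pow (by decide), Even.neg_pow (by decide)]
  ring

theorem g8Disc_add_neg {q : ℂ} (hq : ‖q‖ < 1) : g8Disc q + g8Disc (-q)
    = 8 * (g8Disc (q ^ 2) + 4 * g8Disc (q ^ 2) ^ 2) := by
  have hA := thetaPhi_ne_zero hq
  have hB := thetaPhi_ne_zero (q := -q) (by simpa using hq)
  rw [g8Disc_sq_eq hq, g8Disc_eq hq, g8Disc_eq (q := -q) (by simpa using hq), neg_neg]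
  field_simp
  ring

theorem g8Disc_mul_neg {q : ℂ} (hq : ‖q‖ < 1) : g8Disc q * g8Disc (-q)
    = -(g8Disc (q ^ 2) + 4 * g8Disc (q ^ 2) ^ 2) := by
  have hA := thetaPhi_ne_zero hq
  have hB := thetaPhi_ne_zero (q := -q) (by simpa using hq)
  rw [g8Disc_sq_eq hq, g8Disc_eq hq, g8Disc_eq (q := -q) (by simpa using hq), neg_neg]
  field_simp
  ring

theorem inv_thetaPhi_add_neg {q : ℂ} (hq : ‖q‖ < 1) : (thetaPhi q)⁻¹ + (thetaPhi (-q))⁻¹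
    = 2 * ((thetaPhi (q ^ 4))⁻¹ * (1 + 4 * g8Disc (q ^ 2))) := by
  have hA := thetaPhi_ne_zero hq
  have hB := thetaPhi_ne_zero (q := -q) (by simpa using hq)
  have hC := thetaPhi_ne_zero (norm_pow_lt_one' hq four_ne_zero)
  rw [g8Disc_sq_eq hq, thetaPhi_pow_four hq]
  rw [thetaPhi_pow_four hq] at hC
  have hC' : thetaPhi q + thetaPhi (-q) ≠ 0 := fun h => hC (by simp [h])
  field_simp
  ring

theorem inv_thetaPhi_mul_add_neg {q : ℂ} (hq : ‖q‖ < 1) :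
    (thetaPhi q)⁻¹ * g8Disc q + (thetaPhi (-q))⁻¹ * g8Disc (-q)
      = 2 * ((thetaPhi (q ^ 4))⁻¹ * (2 * g8Disc (q ^ 2) + 8 * g8Disc (q ^ 2) ^ 2)) := by
  have hA := thetaPhi_ne_zero hq
  have hB := thetaPhi_ne_zero (q := -q) (by simpa using hq)
  have hC := thetaPhi_ne_zero (norm_pow_lt_one' hq four_ne_zero)
  rw [g8Disc_sq_eq hq, g8Disc_eq hq, g8Disc_eq (q := -q) (by simpa using hq), neg_neg,
    thetaPhi_pow_four hq]
  rw [thetaPhi_pow_four hq] at hC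
  have hC' : thetaPhi q + thetaPhi (-q) ≠ 0 := fun h => hC (by simp [h])
  field_simp
  ring

end Theta

/-! ### From functions on the disc to formal power series -/

section Transfer

open Filter Topology PowerSeries

open UpperHalfPlane hiding I
open ModularForm

/-- The power series `F` converges to the function `f` on the punctured unit disc. -/
def ConvergesTo (F : PowerSeries ℂ) (f : ℂ → ℂ) : Prop :=
  ∀ q : ℂ, q ≠ 0 → ‖q‖ < 1 → HasSum (fun n : ℕ => coeff n F * q ^ n) (f q)

theorem exists_qParam_eq {q : ℂ} (hq0 : q ≠ 0) (hq : ‖q‖ < 1) :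
    ∃ τ : ℍ, Function.Periodic.qParam 1 (τ : ℂ) = q := by
  have h := Function.Periodic.qParam_right_inv one_ne_zero hq0
  refine ⟨⟨Function.Periodic.invQParam 1 q, ?_⟩, h⟩
  rw [Function.Periodic.im_invQParam]
  have := Real.log_neg (norm_pos_iff.mpr hq0) hq
  have hpi := Real.pi_pos
  exact mul_pos_of_neg_of_neg (div_neg_of_neg_of_pos (by norm_num) (by positivity)) this

namespace ConvergesTo

variable {F G : PowerSeries ℂ} {f g : ℂ → ℂ}

theorem congr (hF : ConvergesTo F f) (h : ∀ q, ‖q‖ < 1 → f q = g q) : ConvergesTo F g :=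
  fun q hq0 hq => h q hq ▸ hF q hq0 hq

theorem add (hF : ConvergesTo F f) (hG : ConvergesTo G g) :
    ConvergesTo (F + G) fun q => f q + g q := fun q hq0 hq => by
  simpa [add_mul] using (hF q hq0 hq).add (hG q hq0 hq)

theorem const (a : ℂ) : ConvergesTo (C a) fun _ => a := fun q hq0 hq => by
  convert hasSum_single (f := fun n : ℕ => coeff n (C a) * q ^ n) 0 fun n hn => ?_ using 1
  · simp
  · simp [coeff_C, hn]

theorem mul (hF : ConvergesTo F f) (hG : ConvergesTo G g) :
    ConvergesTo (F * G) fun q => f q * g q := fun q hq0 hq => by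
  have h1 := hF q hq0 hq
  have h2 := hG q hq0 hq
  have s1 := h1.summable.norm
  have s2 := h2.summable.norm
  have h := tsum_mul_tsum_eq_tsum_sum_antidiagonal_of_summable_norm s1 s2
  have s := (summable_norm_sum_mul_antidiagonal_of_summable_norm s1 s2).of_norm.hasSum
  rw [← h, h1.tsum_eq, h2.tsum_eq] at s
  refine s.congr_fun fun n => ?_
  rw [coeff_mul, Finset.sum_mul]
  refine Finset.sum_congr rfl fun k hk => ?_
  rw [← Finset.HasAntidiagonal.mem_antidiagonal.mp hk]
  ring

theorem evalNeg (hF : ConvergesTo F f) : ConvergesTo (evalNegHom F) fun q => f (-q) :=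
    fun q hq0 hq => by
  refine (hF (-q) (neg_ne_zero.mpr hq0) (by simpa using hq)).congr_fun fun n => ?_
  rw [evalNegHom, coeff_rescale, neg_pow q]
  ring

theorem expand (hF : ConvergesTo F f) (p : ℕ) (hp : p ≠ 0) :
    ConvergesTo (PowerSeries.expand p hp F) fun q => f (q ^ p) := fun q hq0 hq => by
  have hinj : Function.Injective fun n : ℕ => p * n := mul_right_injective₀ hp
  rw [← hinj.hasSum_iff]
  · refine (hF (q ^ p) (pow_ne_zero p hq0) (norm_pow_lt_one' hq hp)).congr_fun fun n => ?_
    simp [coeff_expand_mul, pow_mul]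
  · intro n hn
    rw [coeff_expand_of_not_dvd, zero_mul]
    rintro ⟨m, rfl⟩
    exact hn ⟨m, rfl⟩

/-- The difference is a q-expansion of the zero function on the upper half-plane, so uniqueness of
power series at the cusp applies. -/
theorem unique (hF : ConvergesTo F f) (hG : ConvergesTo G f) : F = G := by
  rw [← sub_eq_zero]
  ext n
  have h0 : ∀ τ : ℍ, HasSum (fun m => coeff m (F - G) • Function.Periodic.qParam 1 (τ : ℂ) ^ m)
      ((0 : ℍ → ℂ) τ) := fun τ => by
    have hq := norm_qParam_lt_one 1 τ
    have hq0 : Function.Periodic.qParam 1 (τ : ℂ) ≠ 0 := Function.Periodic.qParam_ne_zero _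
    simpa [sub_mul] using (hF _ hq0 (by simpa using hq)).sub (hG _ hq0 (by simpa using hq))
  -- The value at the cusp itself is defined as a limit, so it has to be computed.
  have hc : cuspFunction 1 (0 : ℍ → ℂ) = 0 := by
    simpa [cuspFunction, Function.Periodic.cuspFunction]
      using! (tendsto_const_nhds.mono_left nhdsWithin_le_nhds).limUnder_eq
  have h := hasFPowerSeriesOnBall_cuspFunction one_pos (by rw [hc]; exact analyticAt_const) h0
  have h' := h.hasFPowerSeriesAt
  rw [hc] at h'
  exact congr_fun ((FormalMultilinearSeries.ofScalars_series_eq_zero ℂ).mp h'.eq_zero) n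

end ConvergesTo

theorem convergesTo_Phi2 : ConvergesTo Phi2 fun q => (thetaPhi (-q))⁻¹ := fun q hq0 hq => by
  obtain ⟨τ, rfl⟩ := exists_qParam_eq hq0 hq
  convert hasSum_Phi2 τ using 1
  have e1 := eta_nat_mul 1 τ
  have e2 := eta_nat_mul 2 τ
  have h0 : Function.Periodic.qParam 24 (τ : ℂ) ≠ 0 := Function.Periodic.qParam_ne_zero _
  have h1 := eulerProd_ne_zero hq
  push_cast at e1 e2
  rw [one_mul, pow_one, pow_one] at e1
  simp only [phi2, e1, e2, thetaPhi_neg]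
  field_simp

theorem convergesTo_G8 : ConvergesTo G8 g8Disc := fun q hq0 hq => by
  obtain ⟨τ, rfl⟩ := exists_qParam_eq hq0 hq
  convert hasSum_G8 τ using 1
  have e1 := eta_nat_mul 1 τ
  have e2 := eta_nat_mul 2 τ
  have e4 := eta_nat_mul 4 τ
  have e8 := eta_nat_mul 8 τ
  have h0 : Function.Periodic.qParam 24 (τ : ℂ) ≠ 0 := Function.Periodic.qParam_ne_zero _
  have h1 := eulerProd_ne_zero hq
  have h4 := eulerProd_ne_zero (norm_pow_lt_one' hq four_ne_zero)
  push_cast at e1 e2 e4 e8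
  rw [one_mul, pow_one, pow_one] at e1
  rw [g8, e1, e2, e4, e8, g8Disc, thetaPhi_neg, thetaPsi]
  simp only [← pow_mul]
  norm_num
  rw [div_pow, div_pow, mul_div_assoc', div_div_div_eq, div_eq_div_iff (by positivity)
    (by positivity)]
  rw [← qParam_24_pow τ]
  ring

/-- `φ₂(-q)` converges to `1 / φ(q)`. -/
theorem convergesTo_Phi2Neg : ConvergesTo Phi2Neg fun q => (thetaPhi q)⁻¹ := by
  simpa [Phi2Neg] using convergesTo_Phi2.evalNeg

theorem convergesTo_expand_Phi2NegSq :
    ConvergesTo (expand 2 two_ne_zero Phi2NegSq) fun q => (thetaPhi (q ^ 4))⁻¹ := by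
  have h := (convergesTo_Phi2Neg.expand 2 two_ne_zero).expand 2 two_ne_zero
  simp only [← pow_mul] at h
  exact h

theorem convergesTo_expand_G8 :
    ConvergesTo (expand 2 two_ne_zero G8) fun q => g8Disc (q ^ 2) :=
  convergesTo_G8.expand 2 two_ne_zero

theorem G8_add_evalNeg : G8 + evalNegHom G8
    = C 8 * (expand 2 two_ne_zero G8 + C 4 * (expand 2 two_ne_zero G8 * expand 2 two_ne_zero G8)) :=
  ((convergesTo_G8.add convergesTo_G8.evalNeg).congr fun q hq => by
    rw [g8Disc_add_neg hq, sq (g8Disc (q ^ 2))]).unique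
  ((ConvergesTo.const 8).mul (convergesTo_expand_G8.add
    ((ConvergesTo.const 4).mul (convergesTo_expand_G8.mul convergesTo_expand_G8))))

theorem G8_mul_evalNeg : G8 * evalNegHom G8 = C (-1) *
    (expand 2 two_ne_zero G8 + C 4 * (expand 2 two_ne_zero G8 * expand 2 two_ne_zero G8)) :=
  ((convergesTo_G8.mul convergesTo_G8.evalNeg).congr fun q hq => by
    rw [g8Disc_mul_neg hq, sq (g8Disc (q ^ 2)), neg_one_mul]).unique
  ((ConvergesTo.const (-1)).mul (convergesTo_expand_G8.add
    ((ConvergesTo.const 4).mul (convergesTo_expand_G8.mul convergesTo_expand_G8))))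

theorem Phi2Neg_add_evalNeg : Phi2Neg + evalNegHom Phi2Neg
    = C 2 * (expand 2 two_ne_zero Phi2NegSq * (C 1 + C 4 * expand 2 two_ne_zero G8)) :=
  ((convergesTo_Phi2Neg.add convergesTo_Phi2Neg.evalNeg).congr fun _ hq =>
    inv_thetaPhi_add_neg hq).unique
  ((ConvergesTo.const 2).mul (convergesTo_expand_Phi2NegSq.mul ((ConvergesTo.const 1).add
    ((ConvergesTo.const 4).mul convergesTo_expand_G8))))

theorem Phi2Neg_mul_G8_add_evalNeg : Phi2Neg * G8 + evalNegHom Phi2Neg * evalNegHom G8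
    = C 2 * (expand 2 two_ne_zero Phi2NegSq * (C 2 * expand 2 two_ne_zero G8
      + C 8 * (expand 2 two_ne_zero G8 * expand 2 two_ne_zero G8))) :=
  (((convergesTo_Phi2Neg.mul convergesTo_G8).add
    (convergesTo_Phi2Neg.evalNeg.mul convergesTo_G8.evalNeg)).congr fun q hq => by
    rw [inv_thetaPhi_mul_add_neg hq, sq (g8Disc (q ^ 2))]).unique
  ((ConvergesTo.const 2).mul (convergesTo_expand_Phi2NegSq.mul
    (((ConvergesTo.const 2).mul convergesTo_expand_G8).add
    ((ConvergesTo.const 8).mul (convergesTo_expand_G8.mul convergesTo_expand_G8)))))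

theorem expand_atkinU_two (F : PowerSeries ℂ) :
    C 2 * expand 2 two_ne_zero (atkinU 2 F) = F + evalNegHom F := by
  ext n
  rw [coeff_C_mul, coeff_expand, map_add, evalNegHom, coeff_rescale]
  split_ifs with h
  · obtain ⟨m, rfl⟩ := h
    simp [atkinU, pow_mul]
    ring
  · rw [Odd.neg_one_pow (by simpa [← even_iff_two_dvd] using h)]
    ring

theorem expand_two_injective :
    Function.Injective (expand 2 two_ne_zero : PowerSeries ℂ → PowerSeries ℂ) := by
  intro F G h
  ext n
  rw [← coeff_expand_mul 2 two_ne_zero F, h, coeff_expand_mul]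

end Transfer

/-! ### The polynomial recurrence and its 2-adic bounds -/

section Recurrence

open Polynomial

/-- Evaluation of integer polynomials at `G₈`. -/
abbrev evalG8 (p : ℤ[X]) : PowerSeries ℂ := aeval G8 p

/-- The sequence of polynomials with `P (j + 2) = 8 S P (j + 1) + S P j`, `S = X + 4 X²`. -/
def recPoly (p₀ p₁ : ℤ[X]) : ℕ → ℤ[X]
  | 0 => p₀
  | 1 => p₁
  | j + 2 => 8 * ((X + 4 * X ^ 2) * recPoly p₀ p₁ (j + 1)) + (X + 4 * X ^ 2) * recPoly p₀ p₁ j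

/-- The coefficients of `p` vanish in degrees `r < j / 2`, and the coefficient of degree `r` is
divisible by `2 ^ (2 r - j)`. -/
def IsAdmissible (j : ℕ) (p : ℤ[X]) : Prop :=
  (∀ r, 2 * r < j → p.coeff r = 0) ∧ ∀ r, (2 : ℤ) ^ (2 * r - j) ∣ p.coeff r

theorem coeff_mul_succ (p : ℤ[X]) (r : ℕ) :
    ((X + 4 * X ^ 2) * p).coeff (r + 1) = p.coeff r + 4 * (X * p).coeff r := by
  have h : (X + 4 * X ^ 2) * p = X * (p + C 4 * (X * p)) := by
    rw [show (C 4 : ℤ[X]) = 4 from rfl]; ring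
  rw [h, coeff_X_mul, coeff_add, coeff_C_mul]

theorem coeff_mul_zero (p : ℤ[X]) : ((X + 4 * X ^ 2) * p).coeff 0 = 0 := by
  simp [mul_coeff_zero]

/-- The term X raises the degree by 1 and leaves 2r - j unchanged as j grows by 2. The term 4X²
raises 2r - j by 2, which the 4 covers. -/
theorem IsAdmissible.mul {j : ℕ} {p : ℤ[X]} (h : IsAdmissible j p) :
    IsAdmissible (j + 2) ((X + 4 * X ^ 2) * p) := by
  obtain ⟨h1, h2⟩ := h
  refine ⟨fun r hr => ?_, fun r => ?_⟩
  · rcases r with _ | _ | r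
    · exact coeff_mul_zero p
    · rw [coeff_mul_succ, h1 0 (by omega)]
      simp
    · rw [coeff_mul_succ, coeff_X_mul, h1 _ (by omega), h1 _ (by omega)]
      simp
  · rcases r with _ | _ | r
    · rw [coeff_mul_zero]
      exact dvd_zero _
    · simp
    · rw [coeff_mul_succ, coeff_X_mul]
      refine dvd_add ((pow_dvd_pow _ (by omega)).trans (h2 (r + 1))) ?_
      refine (pow_dvd_pow _ (show 2 * (r + 1 + 1) - (j + 2) ≤ 2 + (2 * r - j) by omega)).trans ?_
      rw [pow_add]
      exact mul_dvd_mul (by norm_num) (h2 r)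

/-- Lowering j by one costs at most one factor of 2, so 8 is more than enough. -/
theorem IsAdmissible.eight_mul {j : ℕ} {p : ℤ[X]} (h : IsAdmissible (j + 1) p) :
    IsAdmissible j (8 * p) := by
  have hc (r : ℕ) : (8 * p).coeff r = 8 * p.coeff r := by
    rw [show (8 : ℤ[X]) = C 8 from rfl, coeff_C_mul]
  refine ⟨fun r hr => by rw [hc, h.1 r (by omega), mul_zero], fun r => ?_⟩
  rw [hc]
  refine (pow_dvd_pow _ (show 2 * r - j ≤ 3 + (2 * r - (j + 1)) by omega)).trans ?_
  rw [pow_add]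
  exact mul_dvd_mul (by norm_num) (h.2 r)

theorem IsAdmissible.add {j : ℕ} {p q : ℤ[X]} (hp : IsAdmissible j p) (hq : IsAdmissible j q) :
    IsAdmissible j (p + q) :=
  ⟨fun r hr => by rw [coeff_add, hp.1 r hr, hq.1 r hr, add_zero],
    fun r => by rw [coeff_add]; exact dvd_add (hp.2 r) (hq.2 r)⟩

theorem isAdmissible_recPoly {p₀ p₁ : ℤ[X]} (h0 : IsAdmissible 0 p₀) (h1 : IsAdmissible 1 p₁) :
    ∀ j, IsAdmissible j (recPoly p₀ p₁ j)
  | 0 => h0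
  | 1 => h1
  | j + 2 => (isAdmissible_recPoly h0 h1 (j + 1)).mul.eight_mul.add (isAdmissible_recPoly h0 h1 j).mul

theorem natDegree_recPoly_le {p₀ p₁ : ℤ[X]} (h0 : p₀.natDegree ≤ 0) (h1 : p₁.natDegree ≤ 2) :
    ∀ j, (recPoly p₀ p₁ j).natDegree ≤ 2 * j
  | 0 => h0
  | 1 => h1
  | j + 2 => by
    have hS : (X + 4 * X ^ 2 : ℤ[X]).natDegree ≤ 2 := by compute_degree
    have h8 : (8 : ℤ[X]).natDegree ≤ 0 := by compute_degree
    have ha := natDegree_recPoly_le h0 h1 j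
    have hb := natDegree_recPoly_le h0 h1 (j + 1)
    exact natDegree_add_le_of_degree_le
      ((natDegree_mul_le_of_le h8 (natDegree_mul_le_of_le hS hb)).trans (by omega))
      ((natDegree_mul_le_of_le hS ha).trans (by omega))

theorem isAdmissible_of_coeff {j : ℕ} {a b c : ℤ} (h0 : 0 < j → a = 0)
    (h1 : (2 : ℤ) ^ (2 - j) ∣ b) (hb : 2 < j → b = 0) (h2 : (2 : ℤ) ^ (4 - j) ∣ c)
    (hc : 4 < j → c = 0) : IsAdmissible j (C a + C b * X + C c * X ^ 2) := by
  have h (r : ℕ) : (C a + C b * X + C c * X ^ 2 : ℤ[X]).coeff r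
      = (if r = 0 then a else 0) + (if r = 1 then b else 0) + (if r = 2 then c else 0) := by
    simp only [coeff_add, coeff_C_mul, coeff_C, coeff_X, coeff_X_pow, mul_ite, mul_one, mul_zero,
      @eq_comm ℕ 1 r]
  refine ⟨fun r hr => ?_, fun r => ?_⟩
  · rcases r with _ | _ | _ | r
    · rw [h]; simpa using h0 (by omega)
    · rw [h]; simpa using hb (by omega)
    · rw [h]; simpa using hc (by omega)
    · rw [h]; simp
  · rcases r with _ | _ | _ | r
    · rw [h]; simp
    · rw [h]; simpa using h1
    · rw [h]; simpa using h2
    · rw [h]; simp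

/-- The polynomials expressing `G₈ʲ | U₂` in `G₈`. -/
def powPoly : ℕ → ℤ[X] := recPoly 1 (4 * X + 16 * X ^ 2)

/-- The polynomials expressing `(Φ₂(-q) G₈ʲ) | U₂` in `G₈`, up to the factor `Φ₂(-q²)`. -/
def twistedPoly : ℕ → ℤ[X] := recPoly (1 + 4 * X) (2 * X + 8 * X ^ 2)

theorem isAdmissible_powPoly (j : ℕ) : IsAdmissible j (powPoly j) := by
  refine isAdmissible_recPoly ?_ ?_ j
  · simpa using isAdmissible_of_coeff (j := 0) (a := 1) (b := 0) (c := 0)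
  · simpa using! isAdmissible_of_coeff (j := 1) (a := 0) (b := 4) (c := 16) (by simp) (by norm_num)
      (by simp) (by norm_num) (by simp)

theorem isAdmissible_twistedPoly (j : ℕ) : IsAdmissible j (twistedPoly j) := by
  refine isAdmissible_recPoly ?_ ?_ j
  · simpa using! isAdmissible_of_coeff (j := 0) (a := 1) (b := 4) (c := 0) (by simp) (by norm_num)
      (by simp) (by norm_num) (by simp)
  · simpa using! isAdmissible_of_coeff (j := 1) (a := 0) (b := 2) (c := 8) (by simp) (by norm_num)
      (by simp) (by norm_num) (by simp)

theorem natDegree_powPoly_le (j : ℕ) : (powPoly j).natDegree ≤ 2 * j :=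
  natDegree_recPoly_le (by simp) (by compute_degree) j

local notation "E₂" => PowerSeries.expand 2 two_ne_zero

/-- A twisted power sum `A xʲ + B yʲ` of `x = G₈(q)`, `y = G₈(-q)` is determined by the
recurrence for `x`, `y`. -/
theorem expand_evalG8_recPoly {A B D : PowerSeries ℂ} {p₀ p₁ : ℤ[X]}
    (h0 : A + B = 2 * (D * E₂ (evalG8 p₀)))
    (h1 : A * G8 + B * PowerSeries.evalNegHom G8 = 2 * (D * E₂ (evalG8 p₁))) : ∀ j : ℕ,
    A * G8 ^ j + B * PowerSeries.evalNegHom G8 ^ j = 2 * (D * E₂ (evalG8 (recPoly p₀ p₁ j)))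
  | 0 => by simpa [recPoly] using h0
  | 1 => by simpa [recPoly] using h1
  | j + 2 => by
    have ha := expand_evalG8_recPoly h0 h1 j
    have hb := expand_evalG8_recPoly h0 h1 (j + 1)
    have hs := G8_add_evalNeg
    have hm := G8_mul_evalNeg
    simp only [map_neg, map_one, map_ofNat] at hs hm
    simp only [recPoly, evalG8, map_add, map_mul, map_pow, aeval_X, map_ofNat] at ha hb ⊢
    set w := E₂ G8
    set y := PowerSeries.evalNegHom G8
    -- Newton's recurrence: the (j+2)-th sum is (x + y) times the (j+1)-th minus xy times the j-th.
    linear_combination (A * G8 ^ (j + 1) + B * y ^ (j + 1)) * hs - (A * G8 ^ j + B * y ^ j) * hm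
      + 8 * (w + 4 * w ^ 2) * hb + (w + 4 * w ^ 2) * ha

theorem atkinU_two_eq {F G : PowerSeries ℂ} (h : F + PowerSeries.evalNegHom F = 2 * E₂ G) :
    atkinU 2 F = G := by
  have h2 : (PowerSeries.C 2 : PowerSeries ℂ) ≠ 0 :=
    (map_ne_zero_iff _ PowerSeries.C_injective).mpr two_ne_zero
  refine expand_two_injective (mul_left_cancel₀ h2 ?_)
  rw [expand_atkinU_two, h, map_ofNat]

theorem atkinU_G8_pow (j : ℕ) : atkinU 2 (G8 ^ j) = evalG8 (powPoly j) := by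
  refine atkinU_two_eq ?_
  have h := expand_evalG8_recPoly (A := 1) (B := 1) (D := 1) (p₀ := 1) (p₁ := 4 * X + 16 * X ^ 2)
    (by simp; norm_num) (by
      have hs := G8_add_evalNeg
      simp only [map_ofNat] at hs
      simp only [evalG8, map_add, map_mul, map_pow, aeval_X, map_ofNat]
      linear_combination hs) j
  rw [map_pow]
  simpa [powPoly] using h

theorem atkinU_Phi2Neg_mul_G8_pow (j : ℕ) :
    atkinU 2 (Phi2Neg * G8 ^ j) = Phi2NegSq * evalG8 (twistedPoly j) := by
  refine atkinU_two_eq ?_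
  have h := expand_evalG8_recPoly (A := Phi2Neg) (B := PowerSeries.evalNegHom Phi2Neg)
    (D := E₂ Phi2NegSq) (p₀ := 1 + 4 * X) (p₁ := 2 * X + 8 * X ^ 2)
    (by
      have hs := Phi2Neg_add_evalNeg
      simp only [map_ofNat, map_one] at hs
      simp only [evalG8, map_add, map_mul, map_one, aeval_X, map_ofNat]
      linear_combination hs) (by
      have hs := Phi2Neg_mul_G8_add_evalNeg
      simp only [map_ofNat] at hs
      simp only [evalG8, map_add, map_mul, map_pow, aeval_X, map_ofNat]
      linear_combination hs) j
  rw [map_mul, map_mul, map_pow, h]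
  rfl

theorem evalG8_eq_sum (p : ℤ[X]) {n : ℕ} (h : p.natDegree < n) :
    evalG8 p = ∑ r ∈ Finset.range n, (p.coeff r : ℂ) • G8 ^ r := by
  rw [evalG8, aeval_eq_sum_range' h]
  refine Finset.sum_congr rfl fun r _ => ?_
  rw [Algebra.smul_def, eq_intCast, Int.cast_smul_eq_zsmul, zsmul_eq_mul]

/-- The coefficient 0 is excluded because `padicValInt` takes the value 0 there rather than ∞. The
exponent in `IsAdmissible` is truncated, but for 2r < j the integer bound is negative and holds
trivially. -/
theorem IsAdmissible.le_padicValInt {j : ℕ} {p : ℤ[X]} (h : IsAdmissible j p) {r : ℕ}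
    (hr : p.coeff r ≠ 0) : 2 * (r : ℤ) - (j : ℤ) ≤ (padicValInt 2 (p.coeff r) : ℤ) := by
  have := (padicValInt_dvd_iff (p := 2) (2 * r - j) (p.coeff r)).mp (by exact_mod_cast h.2 r)
  have := this.resolve_left hr
  omega

end Recurrence

end Overpartition

end
open scoped PowerSeries.WithPiTopology in
theorem mainTheorem4 (j : ℕ) (hj : 1 ≤ j) :
    ∃ t u : ℕ → ℤ,
      Overpartition.atkinU 2 (Overpartition.G8 ^ j)
          = ∑ r ∈ Finset.Icc ⌈(j : ℚ) / 2⌉₊ (2 * j), (t r : ℂ) • Overpartition.G8 ^ r ∧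
      (∃ S : PowerSeries ℂ,
        HasSum (fun r : ℕ => (u (r + 1) : ℂ) • Overpartition.G8 ^ (r + 1)) S ∧
        Overpartition.atkinU 2 (Overpartition.Phi2Neg * Overpartition.G8 ^ j)
          = Overpartition.Phi2NegSq * S) ∧
      (∀ r ∈ Finset.Icc ⌈(j : ℚ) / 2⌉₊ (2 * j),
        t r ≠ 0 → 2 * (r : ℤ) - (j : ℤ) ≤ (padicValInt 2 (t r) : ℤ)) ∧
      (∀ r : ℕ, 1 ≤ r → u r ≠ 0 → 2 * (r : ℤ) - (j : ℤ) ≤ (padicValInt 2 (u r) : ℤ)) := by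
  have ht := Overpartition.isAdmissible_powPoly j
  have hu := Overpartition.isAdmissible_twistedPoly j
  refine ⟨(Overpartition.powPoly j).coeff, (Overpartition.twistedPoly j).coeff, ?_,
    ⟨Overpartition.evalG8 (Overpartition.twistedPoly j), ?_,
      Overpartition.atkinU_Phi2Neg_mul_G8_pow j⟩,
    fun r _ hr => ht.le_padicValInt hr, fun r _ hr => hu.le_padicValInt hr⟩
  · rw [Overpartition.atkinU_G8_pow, Overpartition.evalG8_eq_sum _
      (Nat.lt_succ_of_le (Overpartition.natDegree_powPoly_le j))]
    -- Extending the sum down to r = 0 adds only degrees r < j/2, where admissibility makes the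
    -- coefficients vanish.
    refine (Finset.sum_subset (fun r hr => ?_) fun r hr hr' => ?_).symm
    · simp only [Finset.mem_Icc, Finset.mem_range] at hr ⊢
      omega
    · simp only [Finset.mem_Icc, Finset.mem_range, not_and, not_le, Nat.ceil_le] at hr hr'
      have hlt : 2 * r < j := by
        by_contra hc
        have : (j : ℚ) / 2 ≤ r := by
          rw [div_le_iff₀ two_pos]
          exact_mod_cast (by omega : j ≤ r * 2)
        have := hr' this
        omega
      rw [ht.1 r hlt, Int.cast_zero, zero_smul]
  -- The infinite sum is in fact finite. Its constant term vanishes by admissibility, since j ≥ 1,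
  -- so it starts at r = 1.
  · rw [Overpartition.evalG8_eq_sum _ (Nat.lt_succ_of_lt (Nat.lt_succ_self _)),
      Finset.sum_range_succ', hu.1 0 (by omega), Int.cast_zero, zero_smul, add_zero]
    refine hasSum_sum_of_ne_finset_zero fun r hr => ?_
    rw [Finset.mem_range, not_lt] at hr
    rw [Polynomial.coeff_eq_zero_of_natDegree_lt (by omega), Int.cast_zero, zero_smul]
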